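/- For real $\mu,\nu$ let $T_{\mu\nu}:\mathbb{R}^2\to\mathbb{R}^2$ be the piecewise-linear homeomorphism $T_{\mu\nu}(x,y)=(F(x)\,x-y,\;x)$, where $F(x)=\nu+\mu$ if $x\ge 0$ and $F(x)=\nu-\mu$ if $x<0$. Identifying $\mathbb{R}^2$ with $\mathbb{C}$, let $S_{\mu\nu}(e^{i\theta})=T_{\mu\nu}(e^{i\theta})/|T_{\mu\nu}(e^{i\theta})|$ be the induced orientation-preserving homeomorphism of the unit circle, and let $r(S_{\mu\nu})\in\mathbb{R}/\mathbb{Z}$ be its (counterclockwise) rotation number, that is, the class modulo $1$ of $\lim_{n\to\infty}\tilde S^{\,n}(t)/n$ for a continuous lift $\tilde S:\mathbb{R}\to\mathbb{R}$ of $S_{\mu\nu}$ with respect to $t\mapsto e^{2\pi i t}$. For $\mu,r\in\mathbb{R}$ let $I_\mu(r)=\{\nu\in\mathbb{R}: r(S_{\mu\nu})\equiv r \pmod 1\}$ be the rotation interval, and let $$E(r)=\{\mu\ge 0:\ I_\mu(r)\text{ consists of a single point}\}.$$ **Theorem 4.2.** Let $q\ge 3$ be prime and let $j$ be an integer with $1\le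 j\le \frac{q-1}{2}$. Then $E(j/q)$ is a finite set of algebraic numbers, with at most $2^{q-1}(2q-1)$ elements. -/

import Mathlib

namespace PLMap

/-- The slope function: `a` on `x ≥ 0` and `b` on `x < 0`. -/
noncomputable def slopeFn (a b x : ℝ) : ℝ :=
  if 0 ≤ x then a else b

/-- The piecewise-linear map `(x, y) ↦ (F x * x - y, x)` of the plane, with `F` equal to `a` for
`x ≥ 0` and to `b` for `x < 0`. -/
noncomputable def planeMap (a b : ℝ) (v : ℝ × ℝ) : ℝ × ℝ :=
  (slopeFn a b v.1 * v.1 - v.2, v.1)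

/-- The same map in the parameters `μ = (a - b) / 2`, `ν = (a + b) / 2`, that is
`a = ν + μ`, `b = ν - μ`. -/
noncomputable def T (μ ν : ℝ) : ℝ × ℝ → ℝ × ℝ :=
  planeMap (ν + μ) (ν - μ)

/-- The image under `T μ ν` of a point of the unit circle, with the plane identified with `ℂ`
through `(x, y) = x + i y`. -/
noncomputable def circleImage (μ ν : ℝ) (z : Circle) : ℂ :=
  ⟨(T μ ν ((z : ℂ).re, (z : ℂ).im)).1, (T μ ν ((z : ℂ).re, (z : ℂ).im)).2⟩

theorem circleImage_ne_zero (μ ν : ℝ) (z : Circle) : circleImage μ ν z ≠ 0 := by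
  intro h
  have h1 : (z : ℂ).re = 0 := congrArg Complex.im h
  have h2 : slopeFn (ν + μ) (ν - μ) (z : ℂ).re * (z : ℂ).re - (z : ℂ).im = 0 :=
    congrArg Complex.re h
  rw [h1, mul_zero, zero_sub, neg_eq_zero] at h2
  exact z.coe_ne_zero (Complex.ext h1 h2)

/-- The associated circle map `S(e^{iθ}) = T(e^{iθ}) / |T(e^{iθ})|`. -/
noncomputable def S (μ ν : ℝ) (z : Circle) : Circle :=
  ⟨circleImage μ ν z / (‖circleImage μ ν z‖ : ℂ), by
    have h : ‖circleImage μ ν z‖ ≠ 0 := norm_ne_zero_iff.mpr (circleImage_ne_zero μ ν z)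
    change circleImage μ ν z / (‖circleImage μ ν z‖ : ℂ) ∈ Metric.sphere (0 : ℂ) 1
    rw [mem_sphere_zero_iff_norm, norm_div, Complex.norm_real, norm_norm, div_self h]⟩

/-- `F` is a lift of the circle map `f` to the real line, for the (counterclockwise) covering
`t ↦ e^{2 π i t}`: a continuous nondecreasing function with `F (t + 1) = F t + 1` that covers `f`. -/
def IsLift (F : CircleDeg1Lift) (f : Circle → Circle) : Prop :=
  Continuous F ∧ ∀ t : ℝ, f (Circle.exp (2 * Real.pi * t)) = Circle.exp (2 * Real.pi * F t)

/-- The circle map `f` has rotation number `r` modulo `1`: some lift `F` of `f` has translation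
number `lim F^n(t) / n` equal to `r`. (Any two lifts differ by an integer constant, so that the
translation numbers of all the lifts form one class modulo `1`.) -/
def HasRotationNumber (f : Circle → Circle) (r : ℝ) : Prop :=
  ∃ F : CircleDeg1Lift, IsLift F f ∧ F.translationNumber = r

/-- The rotation interval in the variable `ν`, for fixed `μ` and rotation number `r`. -/
def rotationInterval (μ r : ℝ) : Set ℝ :=
  {ν : ℝ | HasRotationNumber (S μ ν) r}

/-- The set of all `μ ≥ 0` at which the rotation interval of rotation number `r` is degenerate,
that is, a single point. -/
def degenerateSet (r : ℝ) : Set ℝ :=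
  {μ : ℝ | 0 ≤ μ ∧ ∃ ν₀ : ℝ, rotationInterval μ r = {ν₀}}

end PLMap

/-! Let `I_μ(j/q) = {ν}` and let `F` be the lift with translation number `j/q`. Raising `ν` by `ε`
composes the circle map with a shear, which moves the lift monotonically. If `F^q` differed from `t
+ j` anywhere, a small shear of suitable sign would keep the rotation number, so `F^q = t + j`
(`pow_eq_add_of_rotationInterval_eq_singleton`). Thus `T^q` fixes every direction. On one side of
`(0,-1)` it is linear of determinant one, so it fixes `(0,-1)`.

The abscissae `u` of this orbit satisfy `u_{i+2} = (ν ± μ) u_{i+1} - u_i`, with `u_0 = u_q = 0`,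
`u_1 = 1`, `u_{q-1} = -1`. Their signs form one of `q` rotation words (`exists_rotation_word`). For
a fixed word the closing conditions are two polynomial equations in `(μ, ν)`, and eliminating `ν` by
a resultant leaves an equation for `μ` of degree at most `2(q-1)(q-2)`.

The crux is that the resultant is nonzero. Otherwise the two curves share a component, monic in `ν`,
which therefore meets `μ = 0` over `ℂ`. Along a tangent direction there, both conditions vanish to
first order. At `μ = 0` the recurrence is governed by a primitive `q`-th root of unity, and for `q`
prime this would force equal signs at `1` and `q - 1` (`variation_eq_zero`); but `u_1 > 0 >
u_{q-1}`. -/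

open Polynomial Filter Topology

namespace PLMap

/-! ### Resultants and elimination. -/

/-- A bound for the degree of a resultant whose entries are themselves polynomials. -/
theorem natDegree_resultant_le {R : Type*} [CommRing R] (f g : R[X][X]) (m n df dg : ℕ)
    (hf : ∀ i, (f.coeff i).natDegree ≤ df) (hg : ∀ i, (g.coeff i).natDegree ≤ dg) :
    (resultant f g m n).natDegree ≤ m * dg + n * df := by
  rw [resultant, Matrix.det_apply]
  refine natDegree_sum_le_of_forall_le _ _ fun σ _ => ?_
  refine (natDegree_smul_le _ _).trans ((natDegree_prod_le _ _).trans ?_)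
  rw [Fin.sum_univ_add]
  refine add_le_add ?_ ?_
  · refine (Finset.sum_le_card_nsmul _ _ dg fun i _ => ?_).trans (by simp)
    simp only [sylvester, Matrix.of_apply, Fin.addCases_left]
    split_ifs
    · exact hg _
    · simp
  · refine (Finset.sum_le_card_nsmul _ _ df fun i _ => ?_).trans (by simp)
    simp only [sylvester, Matrix.of_apply, Fin.addCases_right]
    split_ifs
    · exact hf _
    · simp

/-- Monic polynomials with vanishing resultant have a monic common factor of positive degree. -/
theorem exists_monic_common_factor {R : Type*} [CommRing R] [IsDomain R] [IsIntegrallyClosed R]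
    {f g : R[X]} (hf : f.Monic) (hg : g.Monic) (h : resultant f g = 0) :
    ∃ G : R[X], G.Monic ∧ 0 < G.natDegree ∧ G ∣ f ∧ G ∣ g := by
  let K := FractionRing R
  let L := AlgebraicClosure K
  have : Module.IsTorsionFree R L := .trans_faithfulSMul R K L
  have h1 : resultant (f.map (algebraMap R K)) (g.map (algebraMap R K)) = 0 := by
    rw [hf.natDegree_map, hg.natDegree_map, resultant_map_map, h, map_zero]
  have h2 : ¬ IsCoprime (f.map (algebraMap R K)) (g.map (algebraMap R K)) := by
    intro hc
    exact resultant_ne_zero _ _ hc h1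
  rw [isCoprime_iff_aeval_ne_zero_of_isAlgClosed K L] at h2
  push Not at h2
  obtain ⟨α, ha, hb⟩ := h2
  rw [aeval_map_algebraMap] at ha hb
  -- Integrality of the common root keeps its minimal polynomial over `R`, so no denominators enter
  -- and the factor is monic.
  have hi : IsIntegral R α := ⟨f, hf, ha⟩
  exact ⟨minpoly R α, minpoly.monic hi, minpoly.natDegree_pos hi,
    minpoly.isIntegrallyClosed_dvd hi ha, minpoly.isIntegrallyClosed_dvd hi hb⟩

/-- The resultant lies in the ideal generated by `f` and `g`, so it vanishes wherever both do. -/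
theorem eval_resultant_eq_zero {R A : Type*} [CommRing R] [CommRing A] (φ : R →+* A)
    {f g : R[X]} (hf : 0 < f.natDegree) {x : A} (h1 : f.eval₂ φ x = 0) (h2 : g.eval₂ φ x = 0) :
    φ (resultant f g) = 0 := by
  obtain ⟨p, r, -, -, h⟩ := exists_mul_add_mul_eq_C_resultant f g le_rfl le_rfl (Or.inl hf.ne')
  have := congrArg (eval₂ φ x) h
  simpa [h1, h2, eval₂_mul] using this.symm


/-! ### Linear recurrences, roots of unity and transversality. -/

/-- A nontrivial integer combination of `1, η, …, η ^ (q - 2)` does not vanish, for `η` a primitive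
`q`-th root of unity of prime order. -/
theorem coeff_eq_zero_of_primitiveRoot {q : ℕ} (hq : q.Prime) {η : ℂ} (hη : IsPrimitiveRoot η q)
    (d : ℕ → ℚ) (h : ∑ k ∈ Finset.range (q - 1), (d k : ℂ) * η ^ k = 0) {k : ℕ} (hk : k < q - 1) :
    d k = 0 := by
  set p : ℚ[X] := ∑ k ∈ Finset.range (q - 1), C (d k) * X ^ k with hp
  have hroot : aeval η p = 0 := by simpa [hp] using h
  have hdvd := minpoly.dvd ℚ η hroot
  rw [← cyclotomic_eq_minpoly_rat hη hq.pos] at hdvd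
  -- Primality enters here: the cyclotomic polynomial has degree `q - 1`.
  have hdeg : p.degree < (cyclotomic q ℚ).degree := by
    rw [degree_cyclotomic, Nat.totient_prime hq, hp]
    refine (degree_sum_le _ _).trans_lt ?_
    rw [Finset.sup_lt_iff (by exact WithBot.bot_lt_coe _)]
    intro b hb
    exact (degree_C_mul_X_pow_le _ _).trans_lt (by exact_mod_cast Finset.mem_range.mp hb)
  have h0 : p = 0 := by
    by_contra hne
    exact absurd (degree_le_of_dvd hdvd hne) (not_le.mpr hdeg)
  have h1 := congrArg (fun f => coeff f k) h0
  simpa [hp, finsetSum_coeff, coeff_C_mul, coeff_X_pow, hk] using h1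

section Recurrence

variable {K : Type*} [Field K] {c ζ : K} {w x y : ℕ → K}

/-- The second-order operator factors through `ζ` and `ζ⁻¹`, so `x (n + 1) - ζ⁻¹ * x n` is
geometric. -/
theorem recurrence_step (hζ : ζ ≠ 0) (hc : c = ζ + ζ⁻¹) (hx0 : x 0 = 0) (hx1 : x 1 = 1)
    (hx : ∀ n, x (n + 2) = c * x (n + 1) - x n) (n : ℕ) : x (n + 1) = ζ⁻¹ * x n + ζ ^ n := by
  induction n with
  | zero => simp [hx0, hx1]
  | succ n ih =>
    have h : ζ * ζ⁻¹ = 1 := mul_inv_cancel₀ hζ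
    rw [hx, hc, pow_succ]
    linear_combination ζ * ih + x n * h

/-- The same factorization applied to the first variation `y`: the forcing `w * x` accumulates,
weighted by powers of `ζ⁻¹`. Closing of `y` makes the sum vanish. -/
theorem perturbed_recurrence_sum (hζ : ζ ≠ 0) (hc : c = ζ + ζ⁻¹) (hx0 : x 0 = 0)
    (hy0 : y 0 = 0) (hy1 : y 1 = 0)
    (hy : ∀ n, y (n + 2) = c * y (n + 1) + w (n + 1) * x (n + 1) - y n) (n : ℕ) :
    ζ⁻¹ ^ n * (y (n + 1) - ζ⁻¹ * y n) = ∑ i ∈ Finset.range (n + 1), w i * x i * ζ⁻¹ ^ i := by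
  induction n with
  | zero => simp [hx0, hy0, hy1]
  | succ n ih =>
    have h : ζ * ζ⁻¹ = 1 := mul_inv_cancel₀ hζ
    rw [Finset.sum_range_succ, ← ih, hy, hc, pow_succ]
    linear_combination ζ⁻¹ ^ n * y (n + 1) * h

end Recurrence

/-- Transversality: the first variation of the closing condition of a periodic linear recurrence of
prime period `q` is injective, if the two kinds of sites are not arranged symmetrically. -/
theorem variation_eq_zero {q : ℕ} (hq : q.Prime) (hq3 : 3 ≤ q) {ε : ℕ → ℚ} (hε1 : ε 1 ≠ ε (q - 1))
    {c p r : ℂ} {x y : ℕ → ℂ} (hx0 : x 0 = 0) (hx1 : x 1 = 1)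
    (hx : ∀ n, x (n + 2) = c * x (n + 1) - x n) (hxq : x q = 0) (hxq' : x (q - 1) = -1)
    (hy0 : y 0 = 0) (hy1 : y 1 = 0)
    (hy : ∀ n, y (n + 2) = c * y (n + 1) + (r + ε (n + 1) * p) * x (n + 1) - y n)
    (hyq : y q = 0) (hyq' : y (q - 1) = 0) : p = 0 ∧ r = 0 := by
  obtain ⟨ζ, hζ⟩ : ∃ ζ : ℂ, ζ * ζ - c * ζ + 1 = 0 := by
    obtain ⟨s, hs⟩ := IsAlgClosed.exists_pow_nat_eq (c ^ 2 - 4) two_pos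
    exact ⟨(c + s) / 2, by linear_combination hs / 4⟩
  have hζ0 : ζ ≠ 0 := by rintro rfl; simp at hζ
  have hc : c = ζ + ζ⁻¹ := by field_simp; linear_combination -hζ
  have hc' : c = ζ⁻¹ + ζ⁻¹⁻¹ := by rw [inv_inv, hc, add_comm]
  have hs1 := recurrence_step hζ0 hc hx0 hx1 hx
  have hs2 := recurrence_step (inv_ne_zero hζ0) hc' hx0 hx1 hx
  obtain ⟨m, rfl⟩ : ∃ m, q = m + 1 := ⟨q - 1, by omega⟩
  simp only [Nat.add_sub_cancel] at *
  have hζq : ζ ^ (m + 1) = 1 := by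
    have := hs1 m
    rw [hxq, hxq'] at this
    field_simp at this
    rw [pow_succ']
    linear_combination -this
  -- For `ζ = 1` the solution is `x n = n`, which never returns to `0`.
  have hζ1 : ζ ≠ 1 := by
    rintro rfl
    have : ∀ n, x n = n := by
      intro n
      induction n with
      | zero => simpa using hx0
      | succ n ih => rw [hs1, ih]; push_cast; ring
    rw [this] at hxq
    exact Nat.cast_ne_zero.mpr (Nat.succ_ne_zero m) hxq
  have : Fact (m + 1).Prime := ⟨hq⟩
  have hprim : IsPrimitiveRoot ζ (m + 1) := by
    rw [← orderOf_eq_prime hζq hζ1]; exact IsPrimitiveRoot.orderOf ζ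
  have hcop : Nat.Coprime 2 (m + 1) :=
    (Nat.coprime_primes Nat.prime_two hq).mpr (by omega)
  have hη : IsPrimitiveRoot (ζ ^ 2) (m + 1) := hprim.pow_of_coprime 2 hcop
  have hx' : ∀ n, (ζ - ζ⁻¹) * x n = ζ ^ n - ζ⁻¹ ^ n := fun n => by
    have h1 := hs1 n
    have h2 := hs2 n
    rw [inv_inv] at h2
    linear_combination h1 - h2
  set w : ℕ → ℂ := fun n => r + ε n * p with hw
  have hA := perturbed_recurrence_sum (w := w) hζ0 hc hx0 hy0 hy1 hy m
  have hB := perturbed_recurrence_sum (w := w) (inv_ne_zero hζ0) hc' hx0 hy0 hy1 hy m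
  rw [hyq, hyq'] at hA hB
  simp only [mul_zero, sub_zero, inv_inv] at hA hB
  have hA' : ∑ i ∈ Finset.range (m + 1), w i * (1 - (ζ ^ 2)⁻¹ ^ i) = 0 := by
    rw [← mul_zero (ζ - ζ⁻¹), hA, Finset.mul_sum]
    refine Finset.sum_congr rfl fun i _ => ?_
    have h1 : ζ ^ i * ζ⁻¹ ^ i = 1 := by rw [← mul_pow, mul_inv_cancel₀ hζ0, one_pow]
    have h2 : (ζ ^ 2)⁻¹ ^ i = ζ⁻¹ ^ i * ζ⁻¹ ^ i := by rw [← mul_pow, sq, mul_inv]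
    rw [h2]
    linear_combination -w i * ζ⁻¹ ^ i * hx' i - w i * h1
  have hB' : ∑ i ∈ Finset.range (m + 1), w i * ((ζ ^ 2) ^ i - 1) = 0 := by
    rw [← mul_zero (ζ - ζ⁻¹), hB, Finset.mul_sum]
    refine Finset.sum_congr rfl fun i _ => ?_
    have h1 : ζ ^ i * ζ⁻¹ ^ i = 1 := by rw [← mul_pow, mul_inv_cancel₀ hζ0, one_pow]
    have h2 : (ζ ^ 2) ^ i = ζ ^ i * ζ ^ i := by rw [← mul_pow, sq]
    rw [h2]
    linear_combination -w i * ζ ^ i * hx' i + w i * h1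
  set η := ζ ^ 2 with hηdef
  have hg1 : ∑ i ∈ Finset.range (m + 1), η ^ i = 0 := hη.geom_sum_eq_zero hq.one_lt
  have hg2 : ∑ i ∈ Finset.range (m + 1), η⁻¹ ^ i = 0 := hη.inv.geom_sum_eq_zero hq.one_lt
  have hη0 : η ≠ 0 := pow_ne_zero 2 hζ0
  have hp : p = 0 := by
    by_contra hp
    -- Adding the two closing identities leaves the odd part `η ^ i - η⁻¹ ^ i`; the `r` terms drop
    -- out because full geometric sums vanish.
    have h1 : p * ∑ i ∈ Finset.range (m + 1), (ε i : ℂ) * (η ^ i - η⁻¹ ^ i) = 0 := by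
      have h2 : ∑ i ∈ Finset.range (m + 1), w i * (η ^ i - η⁻¹ ^ i) = 0 := by
        have h := congrArg₂ (· + ·) hA' hB'
        simp only [← Finset.sum_add_distrib, add_zero] at h
        rw [← h]
        exact Finset.sum_congr rfl fun i _ => by ring
      have h3 : r * (∑ i ∈ Finset.range (m + 1), η ^ i - ∑ i ∈ Finset.range (m + 1), η⁻¹ ^ i) = 0 := by
        rw [hg1, hg2]; ring
      rw [← Finset.sum_sub_distrib, Finset.mul_sum] at h3
      have h := congrArg₂ (· - ·) h2 h3
      simp only [← Finset.sum_sub_distrib, sub_zero] at h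
      rw [← h, Finset.mul_sum]
      exact Finset.sum_congr rfl fun i _ => by simp only [hw]; ring
    have h4 := (mul_eq_zero.mp h1).resolve_left hp
    rw [Finset.sum_range_succ'] at h4
    simp only [pow_zero, sub_self, mul_zero, add_zero, mul_sub, Finset.sum_sub_distrib] at h4
    rw [← Finset.sum_range_reflect (fun k => (ε (k + 1) : ℂ) * η⁻¹ ^ (k + 1)),
      ← Finset.sum_sub_distrib] at h4
    -- Reflecting the second sum by `η⁻¹ ^ (m - k) = η ^ (k + 1)` and cancelling one `η` leaves
    -- powers below `q - 1 = m`; the coefficient at `k = 0` compares `ε 1` with `ε (q - 1)`.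
    have h5 : ∑ k ∈ Finset.range m, ((ε (k + 1) - ε (m - k) : ℚ) : ℂ) * η ^ k = 0 := by
      refine (mul_eq_zero.mp (?_ : η * _ = 0)).resolve_left hη0
      rw [Finset.mul_sum, ← h4]
      refine Finset.sum_congr rfl fun k hk => ?_
      have hk' := Finset.mem_range.mp hk
      have h6 : m - 1 - k + 1 = m - k := by omega
      have h7 : η⁻¹ ^ (m - k) = η ^ (k + 1) := by
        rw [inv_pow]
        refine inv_eq_of_mul_eq_one_right ?_
        rw [← pow_add, show m - k + (k + 1) = m + 1 by omega, hη.pow_eq_one]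
      rw [h6, h7]
      push_cast
      ring
    have h8 := coeff_eq_zero_of_primitiveRoot hq hη (fun k => ε (k + 1) - ε (m - k)) h5
      (k := 0) (by omega)
    exact hε1 (by simpa [sub_eq_zero] using h8)
  refine ⟨hp, ?_⟩
  subst hp
  simp only [hw, mul_zero, add_zero, ← Finset.mul_sum, Finset.sum_sub_distrib, hg1, zero_sub,
    Finset.sum_const, Finset.card_range, nsmul_eq_mul, mul_one, mul_neg, neg_eq_zero] at hB'
  exact (mul_eq_zero.mp hB').resolve_right (Nat.cast_ne_zero.mpr (Nat.succ_ne_zero m))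


/-! ### Orbit polynomials and their resultant. -/

/-- The slope attached to a sign as a polynomial in `ν`, with coefficients polynomials in `μ`. -/
noncomputable def slopePoly (s : Prop) [Decidable s] : ℚ[X][X] := if s then X + C X else X - C X

/-- The orbit polynomials with `u 0 = 0`, `u 1 = 1` for a given word of signs. -/
noncomputable def orbitPoly (s : ℕ → Prop) [DecidablePred s] : ℕ → ℚ[X][X]
  | 0 => 0
  | 1 => 1
  | n + 2 => slopePoly (s (n + 1)) * orbitPoly s (n + 1) - orbitPoly s n

section Orbit

variable (s : ℕ → Prop) [DecidablePred s]

theorem slopePoly_eq (p : Prop) [Decidable p] :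
    slopePoly p = X + C (if p then X else -X) := by
  unfold slopePoly
  split_ifs
  · rfl
  · rw [C_neg, sub_eq_add_neg]

theorem orbitPoly_monic_natDegree (n : ℕ) :
    (orbitPoly s (n + 1)).Monic ∧ (orbitPoly s (n + 1)).natDegree = n ∧
      (orbitPoly s n).degree < n := by
  induction n with
  | zero => simp [orbitPoly]
  | succ n ih =>
    obtain ⟨h1, h2, h3⟩ := ih
    have hm : (slopePoly (s (n + 1)) * orbitPoly s (n + 1)).Monic := by
      rw [slopePoly_eq]; exact (monic_X_add_C _).mul h1
    have hd : (slopePoly (s (n + 1)) * orbitPoly s (n + 1)).natDegree = n + 1 := by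
      rw [slopePoly_eq, (monic_X_add_C _).natDegree_mul h1, natDegree_X_add_C, h2, add_comm]
    have hlt : (orbitPoly s n).degree < (slopePoly (s (n + 1)) * orbitPoly s (n + 1)).degree := by
      rw [degree_eq_natDegree hm.ne_zero, hd]
      exact h3.trans (by exact_mod_cast Nat.lt_succ_self n)
    refine ⟨hm.sub_of_left hlt, ?_, ?_⟩
    · rw [orbitPoly, natDegree_sub_eq_left_of_natDegree_lt, hd]
      by_cases h0 : orbitPoly s n = 0
      · rw [h0, hd]; simp
      · exact natDegree_lt_natDegree h0 hlt
    · rw [degree_eq_natDegree h1.ne_zero, h2]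
      exact_mod_cast Nat.lt_succ_self n

theorem natDegree_coeff_orbitPoly_le (n : ℕ) :
    (∀ i, ((orbitPoly s (n + 1)).coeff i).natDegree ≤ n) ∧
      ∀ i, ((orbitPoly s n).coeff i).natDegree ≤ n := by
  induction n with
  | zero =>
    refine ⟨fun i => ?_, by simp [orbitPoly]⟩
    simp only [orbitPoly, coeff_one]
    split_ifs <;> simp
  | succ n ih =>
    refine ⟨fun i => ?_, fun i => (ih.1 i).trans (Nat.le_succ n)⟩
    rw [orbitPoly, coeff_sub, slopePoly_eq, add_mul, coeff_add, coeff_C_mul]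
    refine (natDegree_sub_le _ _).trans (max_le ((natDegree_add_le _ _).trans (max_le ?_ ?_)) ?_)
    · cases i with
      | zero => simp
      | succ i => rw [coeff_X_mul]; exact (ih.1 i).trans (Nat.le_succ n)
    · refine natDegree_mul_le.trans ?_
      have : (if s (n + 1) then (X : ℚ[X]) else -X).natDegree ≤ 1 := by split_ifs <;> simp
      have := ih.1 i
      omega
    · exact (ih.2 i).trans (Nat.le_succ n)

/-- Restriction to the line through `(0, ν₀)` with direction `(p, r)`. -/
noncomputable def lineHom (ν₀ p r : ℂ) : ℚ[X][X] →+* ℂ[X] :=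
  eval₂RingHom (eval₂RingHom (algebraMap ℚ ℂ[X]) (C p * X)) (C ν₀ + C r * X)

noncomputable def evalAtZero (ν₀ : ℂ) : ℚ[X][X] →+* ℂ :=
  eval₂RingHom (eval₂RingHom (algebraMap ℚ ℂ) 0) ν₀

theorem eval_lineHom (ν₀ p r : ℂ) (f : ℚ[X][X]) :
    (lineHom ν₀ p r f).eval 0 = evalAtZero ν₀ f := by
  suffices h : (evalRingHom 0).comp (lineHom ν₀ p r) = evalAtZero ν₀ from
    congrArg (fun φ => φ f) h
  refine ringHom_ext (fun a => ?_) ?_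
  · have : (evalRingHom (0 : ℂ)).comp (eval₂RingHom (algebraMap ℚ ℂ[X]) (C p * X)) =
        eval₂RingHom (algebraMap ℚ ℂ) 0 := by
      refine ringHom_ext (fun a => ?_) ?_
      · simp
      · simp
    simpa [lineHom, evalAtZero] using congrArg (fun φ => φ a) this
  · simp [lineHom, evalAtZero]

/-- The derivative at `(0, ν₀)` in the direction `(p, r)`. -/
noncomputable def dirDeriv (ν₀ p r : ℂ) (f : ℚ[X][X]) : ℂ :=
  (derivative (lineHom ν₀ p r f)).eval 0

theorem dirDeriv_mul (ν₀ p r : ℂ) (f g : ℚ[X][X]) :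
    dirDeriv ν₀ p r (f * g) =
      dirDeriv ν₀ p r f * evalAtZero ν₀ g + evalAtZero ν₀ f * dirDeriv ν₀ p r g := by
  simp [dirDeriv, ← eval_lineHom ν₀ p r]

theorem dirDeriv_add (ν₀ p r : ℂ) (f g : ℚ[X][X]) :
    dirDeriv ν₀ p r (f + g) = dirDeriv ν₀ p r f + dirDeriv ν₀ p r g := by
  simp [dirDeriv]

theorem dirDeriv_sub (ν₀ p r : ℂ) (f g : ℚ[X][X]) :
    dirDeriv ν₀ p r (f - g) = dirDeriv ν₀ p r f - dirDeriv ν₀ p r g := by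
  simp [dirDeriv]

theorem dirDeriv_zero (ν₀ p r : ℂ) : dirDeriv ν₀ p r 0 = 0 := by simp [dirDeriv]

theorem dirDeriv_one (ν₀ p r : ℂ) : dirDeriv ν₀ p r 1 = 0 := by simp [dirDeriv]

theorem dirDeriv_slopePoly (ν₀ p r : ℂ) (s : Prop) [Decidable s] :
    dirDeriv ν₀ p r (slopePoly s) = r + (if s then 1 else -1 : ℚ) * p := by
  rw [slopePoly_eq]
  split_ifs <;> simp [dirDeriv, lineHom]

theorem evalAtZero_slopePoly (ν₀ : ℂ) (s : Prop) [Decidable s] :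
    evalAtZero ν₀ (slopePoly s) = ν₀ := by
  rw [slopePoly_eq]
  split_ifs <;> simp [evalAtZero]

/-- The two closing conditions of an orbit of prime period have no common component. -/
theorem resultant_orbitPoly_ne_zero {q : ℕ} (hq : q.Prime) (hq3 : 3 ≤ q) (h1 : s 1)
    (h2 : ¬ s (q - 1)) : resultant (orbitPoly s q) (orbitPoly s (q - 1) + 1) ≠ 0 := by
  intro h0
  have hP : (orbitPoly s q).Monic := by
    have := (orbitPoly_monic_natDegree s (q - 1)).1
    rwa [Nat.sub_add_cancel (by omega)] at this
  have hQ : (orbitPoly s (q - 1) + 1).Monic := by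
    have h := orbitPoly_monic_natDegree s (q - 2)
    rw [show q - 2 + 1 = q - 1 by omega] at h
    refine h.1.add_of_left ?_
    rw [degree_one, degree_eq_natDegree h.1.ne_zero, h.2.1]
    exact_mod_cast (show 0 < q - 2 by omega)
  obtain ⟨G, hG, hGd, ⟨P', hP'⟩, ⟨Q', hQ'⟩⟩ := exists_monic_common_factor hP hQ h0
  obtain ⟨ν₀, hν⟩ : ∃ ν₀ : ℂ, evalAtZero ν₀ G = 0 := by
    obtain ⟨z, hz⟩ := IsAlgClosed.exists_root (G.map (eval₂RingHom (algebraMap ℚ ℂ) 0)) (by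
      rw [degree_eq_natDegree (hG.map _).ne_zero, hG.natDegree_map]
      exact_mod_cast hGd.ne')
    exact ⟨z, by rwa [IsRoot, eval_map] at hz⟩
  -- A nonzero direction tangent to `G = 0` at `(0, ν₀)`; the derivative `D` along it kills all
  -- multiples of `G`.
  obtain ⟨α, β, hαβ, hne⟩ : ∃ α β : ℂ, α * dirDeriv ν₀ 1 0 G + β * dirDeriv ν₀ 0 1 G = 0 ∧
      ¬(α = 0 ∧ β = 0) := by
    by_cases h : dirDeriv ν₀ 1 0 G = 0
    · exact ⟨1, 0, by simp [h], by simp⟩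
    · exact ⟨dirDeriv ν₀ 0 1 G, -dirDeriv ν₀ 1 0 G, by ring, by simp [h]⟩
  set D : ℚ[X][X] → ℂ := fun f => α * dirDeriv ν₀ 1 0 f + β * dirDeriv ν₀ 0 1 f with hD
  have hDG : ∀ f, D (G * f) = 0 := fun f => by
    simp only [hD, dirDeriv_mul, hν]
    linear_combination evalAtZero ν₀ f * hαβ
  have hPe : evalAtZero ν₀ (orbitPoly s q) = 0 := by rw [hP', map_mul, hν, zero_mul]
  have hQe : evalAtZero ν₀ (orbitPoly s (q - 1) + 1) = 0 := by rw [hQ', map_mul, hν, zero_mul]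
  rw [map_add, map_one] at hQe
  have hDP : D (orbitPoly s q) = 0 := by rw [hP', hDG]
  have hDQ : D (orbitPoly s (q - 1)) = 0 := by
    have h : D (orbitPoly s (q - 1) + 1) = 0 := by rw [hQ', hDG]
    simpa [hD, dirDeriv_add, dirDeriv_one] using h
  refine hne (variation_eq_zero hq hq3 (ε := fun n => if s n then 1 else -1) (c := ν₀)
    (x := fun n => evalAtZero ν₀ (orbitPoly s n)) (y := fun n => D (orbitPoly s n))
    ?_ ?_ ?_ ?_ hPe (eq_neg_of_add_eq_zero_left hQe) ?_ ?_ ?_ hDP hDQ)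
  · simp only [h1, h2, if_true, if_false]; norm_num
  · simp [orbitPoly]
  · simp [orbitPoly]
  · intro n
    simp only [orbitPoly, map_sub, map_mul, evalAtZero_slopePoly]
  · simp [orbitPoly, hD, dirDeriv_zero]
  · simp [orbitPoly, hD, dirDeriv_one]
  · intro n
    simp only [orbitPoly, hD, dirDeriv_sub, dirDeriv_mul, evalAtZero_slopePoly, dirDeriv_slopePoly]
    ring

/-- The values of `μ` for which an orbit closes up with given signs are the roots of a nonzero
polynomial of controlled degree. -/
theorem exists_polynomial_of_signs {q : ℕ} (hq : q.Prime) (hq3 : 3 ≤ q) (h1 : s 1)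
    (h2 : ¬ s (q - 1)) : ∃ R : ℚ[X], R ≠ 0 ∧ R.natDegree ≤ 2 * (q - 1) * (q - 2) ∧
      ∀ μ ν : ℝ, (∃ u : ℕ → ℝ, u 0 = 0 ∧ u 1 = 1 ∧ u q = 0 ∧ u (q - 1) = -1 ∧
        ∀ n < q - 1, u (n + 2) = (if s (n + 1) then ν + μ else ν - μ) * u (n + 1) - u n) →
        aeval μ R = 0 := by
  have hP := orbitPoly_monic_natDegree s (q - 1)
  have hQ := orbitPoly_monic_natDegree s (q - 2)
  have hP' := (natDegree_coeff_orbitPoly_le s (q - 1)).1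
  have hQ' := (natDegree_coeff_orbitPoly_le s (q - 2)).1
  rw [show q - 2 + 1 = q - 1 by omega] at hQ hQ'
  rw [show q - 1 + 1 = q by omega] at hP hP'
  refine ⟨_, resultant_orbitPoly_ne_zero s hq hq3 h1 h2, ?_, ?_⟩
  · refine (natDegree_resultant_le _ _ _ _ (q - 1) (q - 2) hP' fun i => ?_).trans ?_
    · rw [coeff_add]
      refine (natDegree_add_le _ _).trans (max_le (hQ' i) ?_)
      rw [coeff_one]; split_ifs <;> simp
    · rw [hP.2.1, natDegree_add_eq_left_of_natDegree_lt (by rw [hQ.2.1, natDegree_one]; omega),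
        hQ.2.1]
      apply le_of_eq; ring
  · rintro μ ν ⟨u, hu0, hu1, huq, huq', hu⟩
    have key : ∀ n, n + 1 ≤ q → eval₂ (aeval μ : ℚ[X] →ₐ[ℚ] ℝ).toRingHom ν (orbitPoly s n) = u n ∧
        eval₂ (aeval μ : ℚ[X] →ₐ[ℚ] ℝ).toRingHom ν (orbitPoly s (n + 1)) = u (n + 1) := by
      intro n
      induction n with
      | zero => simp [orbitPoly, hu0, hu1]
      | succ n ih =>
        intro hn
        obtain ⟨ih1, ih2⟩ := ih (by omega)
        refine ⟨ih2, ?_⟩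
        rw [orbitPoly, eval₂_sub, eval₂_mul, ih1, ih2, hu n (by omega), slopePoly_eq]
        split_ifs <;> simp [sub_eq_add_neg]
    have hk := key (q - 1) (by omega)
    rw [show q - 1 + 1 = q by omega] at hk
    exact eval_resultant_eq_zero (aeval μ : ℚ[X] →ₐ[ℚ] ℝ).toRingHom (x := ν)
      (by rw [hP.2.1]; omega) (by rw [hk.2, huq]) (by rw [eval₂_add, hk.1, huq', eval₂_one]; ring)


end Orbit

/-! ### Shears and rigidity of degenerate rotation intervals. -/

/-- The point of the unit circle over `t` in the covering `t ↦ e^{2πit}`. -/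
noncomputable abbrev circlePt (t : ℝ) : Circle := Circle.exp (2 * Real.pi * t)

theorem circlePt_re (t : ℝ) : (circlePt t : ℂ).re = Real.cos (2 * Real.pi * t) := by
  rw [Circle.coe_exp, Complex.exp_ofReal_mul_I_re]

theorem circlePt_im (t : ℝ) : (circlePt t : ℂ).im = Real.sin (2 * Real.pi * t) := by
  rw [Circle.coe_exp, Complex.exp_ofReal_mul_I_im]

theorem S_eq_iff (μ ν : ℝ) (z w : Circle) :
    S μ ν z = w ↔ ∃ ρ : ℝ, 0 < ρ ∧ circleImage μ ν z = ρ * w := by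
  have h0 : 0 < ‖circleImage μ ν z‖ := norm_pos_iff.mpr (circleImage_ne_zero μ ν z)
  have h0' : (‖circleImage μ ν z‖ : ℂ) ≠ 0 := Complex.ofReal_ne_zero.mpr h0.ne'
  constructor
  · rintro rfl
    exact ⟨_, h0, (mul_div_cancel₀ _ h0').symm⟩
  · rintro ⟨ρ, hρ, h⟩
    apply Circle.ext
    change circleImage μ ν z / (‖circleImage μ ν z‖ : ℂ) = w
    have hn : ‖circleImage μ ν z‖ = ρ := by
      rw [h, norm_mul, Circle.norm_coe, mul_one, Complex.norm_real, Real.norm_of_nonneg hρ.le]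
    rw [hn, h, mul_div_cancel_left₀]
    exact Complex.ofReal_ne_zero.mpr hρ.ne'

/-- The quotient of the image of `e^{2πit}` under the shear `(x, y) ↦ (x + ε y, y)` by `e^{2πit}`. -/
noncomputable def shearFactor (ε t : ℝ) : ℂ :=
  ⟨1 + ε * Real.sin (2 * Real.pi * t) * Real.cos (2 * Real.pi * t),
    -(ε * Real.sin (2 * Real.pi * t) ^ 2)⟩

theorem shearFactor_mul (ε t : ℝ) : shearFactor ε t * circlePt t =
    (circlePt t : ℂ) + (ε * (circlePt t : ℂ).im : ℝ) := by
  have h := Real.sin_sq_add_cos_sq (2 * Real.pi * t)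
  apply Complex.ext
  · simp only [Complex.mul_re, Complex.add_re, Complex.ofReal_re, circlePt_re, circlePt_im,
      shearFactor]
    linear_combination ε * Real.sin (2 * Real.pi * t) * h
  · simp only [Complex.mul_im, Complex.add_im, Complex.ofReal_im, circlePt_re, circlePt_im,
      shearFactor]
    ring

/-- The factor is `1` or has nonzero imaginary part, so its principal argument is continuous jointly
in `ε` and `t`. -/
theorem shearFactor_mem_slitPlane (ε t : ℝ) : shearFactor ε t ∈ Complex.slitPlane := by
  rw [Complex.mem_slitPlane_iff]
  by_cases h : ε * Real.sin (2 * Real.pi * t) = 0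
  · left; simp [shearFactor, h]
  · right
    simp only [shearFactor, sq, neg_ne_zero, ← mul_assoc]
    exact mul_ne_zero h (right_ne_zero_of_mul h)

/-- The lift of the projective action of a shear that is the identity at parameter zero. -/
noncomputable def shearFun (ε t : ℝ) : ℝ := t + (shearFactor ε t).arg / (2 * Real.pi)

theorem continuous_shearFun : Continuous fun p : ℝ × ℝ => shearFun p.1 p.2 := by
  unfold shearFun
  refine continuous_snd.add (Continuous.div_const ?_ _)
  refine continuous_iff_continuousAt.mpr fun p => ?_
  refine (Complex.continuousAt_arg (shearFactor_mem_slitPlane p.1 p.2)).comp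
    (f := fun p : ℝ × ℝ => shearFactor p.1 p.2) (Continuous.continuousAt ?_)
  have : (fun p : ℝ × ℝ => shearFactor p.1 p.2) = fun p : ℝ × ℝ =>
      ((1 + p.1 * Real.sin (2 * Real.pi * p.2) * Real.cos (2 * Real.pi * p.2) : ℝ) : ℂ) +
        ((-(p.1 * Real.sin (2 * Real.pi * p.2) ^ 2) : ℝ) : ℂ) * Complex.I := by
    funext p
    apply Complex.ext <;> simp [shearFactor, -Complex.ofReal_add, -Complex.ofReal_mul,
      -Complex.ofReal_neg, -Complex.ofReal_pow, -Complex.ofReal_sin, -Complex.ofReal_cos]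
  rw [this]
  fun_prop

theorem shearFactor_add_int (ε t : ℝ) (n : ℤ) : shearFactor ε (t + n) = shearFactor ε t := by
  have h : 2 * Real.pi * (t + n) = 2 * Real.pi * t + n * (2 * Real.pi) := by ring
  simp only [shearFactor, h, Real.sin_add_int_mul_two_pi, Real.cos_add_int_mul_two_pi]

theorem shearFun_add_int (ε t : ℝ) (n : ℤ) : shearFun ε (t + n) = shearFun ε t + n := by
  rw [shearFun, shearFactor_add_int, shearFun]; ring

theorem norm_mul_circlePt_shearFun (ε t : ℝ) : (‖shearFactor ε t‖ : ℂ) * circlePt (shearFun ε t) =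
    (circlePt t : ℂ) + (ε * (circlePt t : ℂ).im : ℝ) := by
  have h : 2 * Real.pi * shearFun ε t = (shearFactor ε t).arg + 2 * Real.pi * t := by
    rw [shearFun]
    have := Real.pi_ne_zero
    field_simp
    ring
  rw [← shearFactor_mul, circlePt, h, Circle.exp_add, Circle.coe_mul, ← mul_assoc]
  congr 1
  rw [Circle.coe_exp, Complex.norm_mul_exp_arg_mul_I]

theorem norm_shearFactor_pos (ε t : ℝ) : 0 < ‖shearFactor ε t‖ :=
  norm_pos_iff.mpr (Complex.slitPlane_ne_zero (shearFactor_mem_slitPlane ε t))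

/-- A shear is linear and invertible: if two images are parallel, so are the unit vectors, which
then agree modulo an integer in `t`. -/
theorem shearFun_injective (ε : ℝ) : Function.Injective (shearFun ε) := by
  intro a b hab
  have ha := norm_mul_circlePt_shearFun ε a
  have hb := norm_mul_circlePt_shearFun ε b
  have hpa := norm_shearFactor_pos ε a
  have hpb := norm_shearFactor_pos ε b
  rw [hab] at ha
  set p := ‖shearFactor ε a‖
  set r := ‖shearFactor ε b‖
  have him : r * (circlePt a : ℂ).im = p * (circlePt b : ℂ).im := by
    have h1 := congrArg Complex.im ha
    have h2 := congrArg Complex.im hb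
    simp only [Complex.im_ofReal_mul, Complex.add_im, Complex.ofReal_im, add_zero] at h1 h2
    rw [← h1, ← h2]; ring
  have hre : r * (circlePt a : ℂ).re = p * (circlePt b : ℂ).re := by
    have h1 := congrArg Complex.re ha
    have h2 := congrArg Complex.re hb
    simp only [Complex.re_ofReal_mul, Complex.add_re, Complex.ofReal_re] at h1 h2
    linear_combination p * h2 - r * h1 - ε * him
  have hc : (r : ℂ) * circlePt a = p * circlePt b := by
    apply Complex.ext
    · simpa only [Complex.re_ofReal_mul] using hre
    · simpa only [Complex.im_ofReal_mul] using him
  have hpr : r = p := by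
    have := congrArg norm hc
    rwa [norm_mul, norm_mul, Circle.norm_coe, Circle.norm_coe, mul_one, mul_one,
      Complex.norm_real, Complex.norm_real, Real.norm_of_nonneg hpb.le,
      Real.norm_of_nonneg hpa.le] at this
  rw [hpr] at hc
  have hab' : circlePt a = circlePt b :=
    Circle.ext (mul_left_cancel₀ (Complex.ofReal_ne_zero.mpr hpa.ne') hc)
  obtain ⟨n, hn⟩ := Circle.exp_eq_exp.mp hab'
  have hn' : a = b + n := by
    have := Real.pi_pos
    have h2 : 2 * Real.pi * (a - (b + n)) = 0 := by linear_combination hn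
    rcases mul_eq_zero.mp h2 with h | h
    · linarith
    · linarith
  rw [hn', shearFun_add_int] at hab
  rw [hn']
  linarith

theorem shearFun_strictMono (ε : ℝ) : StrictMono (shearFun ε) := by
  have hc : Continuous (shearFun ε) :=
    continuous_shearFun.comp (continuous_const.prodMk continuous_id)
  refine (hc.strictMono_of_inj (shearFun_injective ε)).resolve_right fun h => ?_
  have h1 := h (zero_lt_one (α := ℝ))
  have h2 := shearFun_add_int ε 0 1
  simp only [Int.cast_one, zero_add] at h2
  linarith

/-- The projective action of a shear as a degree one lift. -/
noncomputable def shearLift (ε : ℝ) : CircleDeg1Lift where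
  toFun := shearFun ε
  monotone' := (shearFun_strictMono ε).monotone
  map_add_one' t := by simpa using shearFun_add_int ε t 1

theorem shearLift_apply (ε t : ℝ) : shearLift ε t = shearFun ε t := rfl

theorem shearFun_le {ε : ℝ} (hε : 0 ≤ ε) (t : ℝ) : shearFun ε t ≤ t := by
  have : (shearFactor ε t).arg ≤ 0 := by
    by_cases h : ε * Real.sin (2 * Real.pi * t) ^ 2 = 0
    · have h' : ε * Real.sin (2 * Real.pi * t) = 0 := by
        rcases mul_eq_zero.mp h with h | h
        · simp [h]
        · simp [pow_eq_zero_iff two_ne_zero |>.mp h]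
      have : shearFactor ε t = 1 := by
        apply Complex.ext <;> simp [shearFactor, h, h']
      simp [this]
    · refine (Complex.arg_neg_iff.mpr ?_).le
      simp only [shearFactor]
      have : 0 ≤ ε * Real.sin (2 * Real.pi * t) ^ 2 := by positivity
      have := lt_of_le_of_ne this (Ne.symm h)
      linarith
  rw [shearFun]
  have := div_nonpos_of_nonpos_of_nonneg this Real.two_pi_pos.le
  linarith

theorem le_shearFun {ε : ℝ} (hε : ε ≤ 0) (t : ℝ) : t ≤ shearFun ε t := by
  have : 0 ≤ (shearFactor ε t).arg := by
    rw [Complex.arg_nonneg_iff]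
    simp only [shearFactor]
    nlinarith [mul_nonneg (neg_nonneg.mpr hε) (sq_nonneg (Real.sin (2 * Real.pi * t)))]
  rw [shearFun]
  have := div_nonneg this Real.two_pi_pos.le
  linarith

theorem shearFun_zero (t : ℝ) : shearFun 0 t = t :=
  le_antisymm (shearFun_le le_rfl t) (le_shearFun le_rfl t)

/-- Increasing `ν` by `ε` composes the map with a shear. -/
theorem IsLift.shear {μ ν : ℝ} {F : CircleDeg1Lift} (hF : IsLift F (S μ ν)) (ε : ℝ) :
    IsLift (shearLift ε * F) (S μ (ν + ε)) := by
  refine ⟨?_, fun t => ?_⟩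
  · rw [CircleDeg1Lift.coe_mul]
    exact (continuous_shearFun.comp (continuous_const.prodMk continuous_id)).comp hF.1
  obtain ⟨ρ, hρ, h⟩ := (S_eq_iff μ ν _ _).mp (hF.2 t)
  rw [S_eq_iff]
  refine ⟨ρ * ‖shearFactor ε (F t)‖, mul_pos hρ (norm_shearFactor_pos _ _), ?_⟩
  have hs := norm_mul_circlePt_shearFun ε (F t)
  rw [CircleDeg1Lift.mul_apply, shearLift_apply, Complex.ofReal_mul, mul_assoc (ρ : ℂ), hs,
    mul_add, ← h]
  have him := congrArg Complex.im h
  rw [Complex.im_ofReal_mul] at him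
  apply Complex.ext
  · have hx : (circleImage μ ν (circlePt t)).im = (circlePt t : ℂ).re := rfl
    rw [hx] at him
    simp only [Complex.add_re, Complex.re_ofReal_mul, Complex.ofReal_re]
    rw [mul_left_comm, ← him]
    simp only [circleImage, T, planeMap, slopeFn]
    split_ifs <;> ring
  · simp [circleImage, T, planeMap]

theorem continuous_shearLift_mul_pow {F : CircleDeg1Lift} (hF : Continuous F) (t : ℝ) (n : ℕ) :
    Continuous fun ε : ℝ => ((shearLift ε * F) ^ n) t := by
  induction n with
  | zero => simpa using continuous_const
  | succ n ih =>
    simp only [pow_succ', CircleDeg1Lift.mul_apply, shearLift_apply]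
    exact continuous_shearFun.comp (continuous_id.prodMk (hF.comp ih))

theorem shearLift_zero_mul (F : CircleDeg1Lift) : shearLift 0 * F = F :=
  CircleDeg1Lift.ext fun t => by rw [CircleDeg1Lift.mul_apply, shearLift_apply, shearFun_zero]

/-- If the rotation interval is a single point, then the circle map there is periodic. -/
theorem pow_eq_add_of_rotationInterval_eq_singleton {μ ν : ℝ} {q j : ℕ} (hq : 0 < q)
    (h : rotationInterval μ (j / q) = {ν}) {F : CircleDeg1Lift} (hF : IsLift F (S μ ν))
    (hτ : F.translationNumber = j / q) (t : ℝ) : (F ^ q) t = t + j := by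
  have hq' : (0 : ℝ) < q := Nat.cast_pos.mpr hq
  have hrig : ∀ ε, (shearLift ε * F).translationNumber = j / q → ε = 0 := fun ε hε => by
    have hmem : ν + ε ∈ rotationInterval μ (j / q) := ⟨_, hF.shear ε, hε⟩
    rw [h, Set.mem_singleton_iff] at hmem
    linarith
  have hcont := continuous_shearLift_mul_pow hF.1 t q
  have hlim : Tendsto (fun ε : ℝ => ((shearLift ε * F) ^ q) t) (𝓝 0) (𝓝 ((F ^ q) t)) := by
    have := hcont.tendsto 0
    rwa [shearLift_zero_mul] at this
  by_contra hne
  -- A strict inequality at `t` survives small shears and bounds the rotation number on one side.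
  -- The sign of `ε` is chosen so that monotonicity bounds it on the other.
  rcases lt_or_gt_of_ne hne with hlt | hgt
  · have hev := (hlim.eventually (gt_mem_nhds hlt)).filter_mono (nhdsWithin_le_nhds (s := Set.Iio 0))
    obtain ⟨ε, hε, hε0⟩ := (hev.and self_mem_nhdsWithin).exists
    have hε0' : ε < 0 := hε0
    refine hε0'.ne (hrig ε (le_antisymm ?_ ?_))
    · have h1 := CircleDeg1Lift.translationNumber_le_of_le_add_nat _ hε.le
      rw [CircleDeg1Lift.translationNumber_pow] at h1
      rw [le_div_iff₀ hq']
      linarith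
    · rw [← hτ]
      exact CircleDeg1Lift.translationNumber_mono fun x => le_shearFun hε0'.le (F x)
  · have hev := (hlim.eventually (lt_mem_nhds hgt)).filter_mono (nhdsWithin_le_nhds (s := Set.Ioi 0))
    obtain ⟨ε, hε, hε0⟩ := (hev.and self_mem_nhdsWithin).exists
    have hε0' : 0 < ε := hε0
    refine hε0'.ne' (hrig ε (le_antisymm ?_ ?_))
    · rw [← hτ]
      exact CircleDeg1Lift.translationNumber_mono fun x => shearFun_le hε0'.le (F x)
    · have h1 := CircleDeg1Lift.le_translationNumber_of_add_nat_le _ hε.le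
      rw [CircleDeg1Lift.translationNumber_pow] at h1
      rw [div_le_iff₀ hq']
      linarith


/-! ### From periodic directions to a periodic vector. -/

theorem T_smul {μ ν ρ : ℝ} (hρ : 0 < ρ) (v : ℝ × ℝ) : T μ ν (ρ • v) = ρ • T μ ν v := by
  have h : slopeFn (ν + μ) (ν - μ) (ρ * v.1) = slopeFn (ν + μ) (ν - μ) v.1 := by
    simp only [slopeFn, mul_nonneg_iff_of_pos_left hρ]
  apply Prod.ext
  · simp only [T, planeMap, Prod.smul_fst, Prod.smul_snd, smul_eq_mul, h]; ring
  · simp [T, planeMap]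

theorem T_iterate_smul {μ ν ρ : ℝ} (hρ : 0 < ρ) (n : ℕ) (v : ℝ × ℝ) :
    (T μ ν)^[n] (ρ • v) = ρ • (T μ ν)^[n] v := by
  induction n with
  | zero => rfl
  | succ n ih => rw [Function.iterate_succ_apply', ih, T_smul hρ, Function.iterate_succ_apply']

/-- The unit vector over `t` in the plane. -/
noncomputable def unitVec (t : ℝ) : ℝ × ℝ :=
  (Real.cos (2 * Real.pi * t), Real.sin (2 * Real.pi * t))

theorem unitVec_add_int (t : ℝ) (n : ℤ) : unitVec (t + n) = unitVec t := by
  have h : 2 * Real.pi * (t + n) = 2 * Real.pi * t + n * (2 * Real.pi) := by ring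
  simp only [unitVec, h, Real.sin_add_int_mul_two_pi, Real.cos_add_int_mul_two_pi]

theorem exists_smul_unitVec {v : ℝ × ℝ} (hv : v ≠ 0) : ∃ ρ t : ℝ, 0 < ρ ∧ v = ρ • unitVec t := by
  obtain ⟨z, hz1, hz2⟩ : ∃ z : ℂ, z.re = v.1 ∧ z.im = v.2 := ⟨⟨v.1, v.2⟩, rfl, rfl⟩
  have hz0 : z ≠ 0 := fun h => hv (Prod.ext (by simp [← hz1, h]) (by simp [← hz2, h]))
  have h2 : 2 * Real.pi * (z.arg / (2 * Real.pi)) = z.arg := by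
    have := Real.pi_ne_zero; field_simp
  refine ⟨‖z‖, z.arg / (2 * Real.pi), norm_pos_iff.mpr hz0, ?_⟩
  apply Prod.ext
  · simp only [unitVec, h2, Prod.smul_fst, smul_eq_mul, Complex.norm_mul_cos_arg, hz1]
  · simp only [unitVec, h2, Prod.smul_snd, smul_eq_mul, Complex.norm_mul_sin_arg, hz2]

theorem IsLift.T_unitVec {μ ν : ℝ} {F : CircleDeg1Lift} (hF : IsLift F (S μ ν)) (t : ℝ) :
    ∃ ρ : ℝ, 0 < ρ ∧ T μ ν (unitVec t) = ρ • unitVec (F t) := by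
  obtain ⟨ρ, hρ, h⟩ := (S_eq_iff μ ν _ _).mp (hF.2 t)
  refine ⟨ρ, hρ, ?_⟩
  have h1 : T μ ν (unitVec t) = ((circleImage μ ν (circlePt t)).re,
      (circleImage μ ν (circlePt t)).im) := by
    simp only [circleImage, circlePt_re, circlePt_im, unitVec]
  rw [h1, h, Complex.re_ofReal_mul, Complex.im_ofReal_mul, circlePt_re, circlePt_im]
  rfl

theorem IsLift.T_iterate_unitVec {μ ν : ℝ} {F : CircleDeg1Lift} (hF : IsLift F (S μ ν)) (t : ℝ)
    (n : ℕ) : ∃ ρ : ℝ, 0 < ρ ∧ (T μ ν)^[n] (unitVec t) = ρ • unitVec (F^[n] t) := by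
  induction n with
  | zero => exact ⟨1, one_pos, by simp⟩
  | succ n ih =>
    obtain ⟨ρ, hρ, h⟩ := ih
    obtain ⟨ρ', hρ', h'⟩ := hF.T_unitVec (F^[n] t)
    refine ⟨ρ * ρ', mul_pos hρ hρ', ?_⟩
    rw [Function.iterate_succ_apply', h, T_smul hρ, h', smul_smul, Function.iterate_succ_apply']

theorem IsLift.T_iterate_of_periodic {μ ν : ℝ} {F : CircleDeg1Lift} (hF : IsLift F (S μ ν))
    {q j : ℕ} (h : ∀ t, F^[q] t = t + j) {v : ℝ × ℝ} (hv : v ≠ 0) :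
    ∃ ρ : ℝ, 0 < ρ ∧ (T μ ν)^[q] v = ρ • v := by
  obtain ⟨r, t, hr, rfl⟩ := exists_smul_unitVec hv
  obtain ⟨ρ, hρ, h1⟩ := hF.T_iterate_unitVec t q
  refine ⟨ρ, hρ, ?_⟩
  have h2 := unitVec_add_int t j
  rw [Int.cast_natCast] at h2
  rw [T_iterate_smul hr, h1, h, h2, smul_comm]

/-- An affine function of `δ` keeps its sign just to the right of `0`: that of `-d`, or of `c` when
`d = 0`. -/
theorem eventually_slopeFn_mul_eq (a b c d : ℝ) :
    ∃ k : ℝ, ∀ᶠ δ in 𝓝[≥] (0 : ℝ),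
      slopeFn a b (c * δ - d) * (c * δ - d) = k * (c * δ - d) := by
  have hcont : Tendsto (fun δ : ℝ => c * δ - d) (𝓝[≥] 0) (𝓝 (-d)) := by
    have : Continuous fun δ : ℝ => c * δ - d := by fun_prop
    simpa using (this.tendsto 0).mono_left nhdsWithin_le_nhds
  rcases lt_trichotomy d 0 with hd | rfl | hd
  · refine ⟨a, ?_⟩
    filter_upwards [hcont.eventually (lt_mem_nhds (neg_pos.mpr hd))] with δ hδ
    rw [slopeFn, if_pos hδ.le]
  · rcases le_or_gt 0 c with hc | hc
    · refine ⟨a, ?_⟩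
      filter_upwards [self_mem_nhdsWithin] with δ hδ
      rw [slopeFn, if_pos (by simpa using mul_nonneg hc hδ)]
    · refine ⟨b, ?_⟩
      filter_upwards [self_mem_nhdsWithin] with δ hδ
      rcases eq_or_lt_of_le (Set.mem_Ici.mp hδ) with rfl | hδ
      · simp
      · rw [slopeFn, if_neg (by simpa using mul_neg_of_neg_of_pos hc hδ)]
  · refine ⟨b, ?_⟩
    filter_upwards [hcont.eventually (gt_mem_nhds (neg_lt_zero.mpr hd))] with δ hδ
    rw [slopeFn, if_neg (not_le.mpr hδ)]

/-- Close to the vertical axis, on one side, the iterates are linear of determinant one. -/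
theorem eventually_T_iterate_eq_linear (μ ν : ℝ) (n : ℕ) : ∃ a b c d : ℝ, a * d - b * c = 1 ∧
    ∀ᶠ δ in 𝓝[≥] (0 : ℝ), (T μ ν)^[n] (δ, -1) = (a * δ - b, c * δ - d) := by
  induction n with
  | zero => exact ⟨1, 0, 0, 1, by norm_num, Eventually.of_forall fun δ => by simp⟩
  | succ n ih =>
    obtain ⟨a, b, c, d, hdet, h⟩ := ih
    obtain ⟨k, hk⟩ := eventually_slopeFn_mul_eq (ν + μ) (ν - μ) a b
    refine ⟨k * a - c, k * b - d, a, b, by linear_combination hdet, ?_⟩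
    filter_upwards [h, hk] with δ h hk
    rw [Function.iterate_succ_apply', h]
    simp only [T, planeMap, hk, Prod.mk.injEq, and_true]
    ring

/-- An iterate that fixes every direction fixes the vector `(0, -1)`. -/
theorem T_iterate_zero_neg_one {μ ν : ℝ} {q : ℕ}
    (h : ∀ v : ℝ × ℝ, v ≠ 0 → ∃ ρ : ℝ, 0 < ρ ∧ (T μ ν)^[q] v = ρ • v) :
    (T μ ν)^[q] (0, -1) = (0, -1) := by
  obtain ⟨a, b, c, d, hdet, hev⟩ := eventually_T_iterate_eq_linear μ ν q
  obtain ⟨e, he, hlin⟩ := mem_nhdsGE_iff_exists_Ico_subset.mp hev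
  -- Being an eigenvector is quadratic in `δ`. Vanishing at `0`, `e / 2` and `e / 3` makes the
  -- matrix scalar; determinant one and positivity make it the identity.
  have hrel : ∀ δ ∈ Set.Ico (0 : ℝ) e, 0 < d - c * δ ∧ c * δ ^ 2 + (a - d) * δ - b = 0 := by
    intro δ hδ
    obtain ⟨ρ, hρ, h1⟩ := h (δ, -1) (fun h => by simpa using congrArg Prod.snd h)
    have h2 : (T μ ν)^[q] (δ, -1) = (a * δ - b, c * δ - d) := hlin hδ
    rw [h2, Prod.smul_mk, smul_eq_mul, smul_eq_mul, Prod.mk.injEq] at h1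
    obtain ⟨h3, h4⟩ := h1
    have h5 : d - c * δ = ρ := by linarith
    exact ⟨h5 ▸ hρ, by linear_combination h3 - δ * h5⟩
  have he' : (0 : ℝ) < e := he
  have h0 := hrel 0 ⟨le_rfl, he'⟩
  have h1 := (hrel (e / 2) ⟨by positivity, by linarith⟩).2
  have h2 := (hrel (e / 3) ⟨by positivity, by linarith⟩).2
  have hb : b = 0 := by linarith [h0.2]
  have hd : 0 < d := by linarith [h0.1]
  subst hb
  have h1' : c * (e / 2) + (a - d) = 0 := by
    refine (mul_eq_zero.mp (?_ : (e / 2) * _ = 0)).resolve_left (by positivity)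
    linear_combination h1
  have h2' : c * (e / 3) + (a - d) = 0 := by
    refine (mul_eq_zero.mp (?_ : (e / 3) * _ = 0)).resolve_left (by positivity)
    linear_combination h2
  have hc : c = 0 := by
    refine (mul_eq_zero.mp (?_ : (e / 6) * _ = 0)).resolve_left (by positivity)
    linear_combination h1' - h2'
  subst hc
  have had : a = d := by linarith
  subst had
  have ha : a = 1 := by nlinarith
  have h3 : (T μ ν)^[q] (0, -1) = (a * 0 - 0, 0 * 0 - a) := hlin (Set.mem_Ico.mpr ⟨le_rfl, he'⟩)
  rw [h3, ha]
  simp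


/-! ### Coding of the orbit by a rotation word. -/

theorem iterate_mul_eq_add {F : ℝ → ℝ} {q j : ℕ} (h : ∀ t, F^[q] t = t + j) (m : ℕ) (t : ℝ) :
    F^[q * m] t = t + m * j := by
  rw [Function.iterate_mul]
  induction m with
  | zero => simp
  | succ m ih => rw [Function.iterate_succ_apply', ih, h]; push_cast; ring

/-- A lift `F` with `F ^ q = id + j` and `j` prime to `q` is the `j`-th power of a degree one
lift `g` with `g ^ q = id + 1`, up to integer translations. -/
theorem exists_root_of_periodic (F : CircleDeg1Lift) {q j : ℕ} (hq : 1 < q) (hj : Nat.Coprime j q)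
    (h : ∀ t, F^[q] t = t + j) : ∃ g : CircleDeg1Lift, (∀ t, g^[q] t = t + 1) ∧
      ∀ i t, g^[i * j] t = F^[i] t := by
  -- With `α` inverse to `j` modulo `q` and `j * α = 1 + q * e`, the root is `g = F^α - e`.
  obtain ⟨α, -, hα⟩ := Nat.exists_mul_mod_eq_one_of_coprime hj hq
  set e := j * α / q
  have hαe : j * α = 1 + q * e := by rw [← hα, Nat.mod_add_div]
  let g : CircleDeg1Lift :=
    ⟨⟨fun t => F^[α] t - e, fun a b hab => sub_le_sub_right (F.monotone.iterate α hab) _⟩, fun t => by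
      have : F^[α] (t + 1) = F^[α] t + 1 := by
        rw [← CircleDeg1Lift.coe_pow]; exact CircleDeg1Lift.map_add_one _ _
      simp only [this]; ring⟩
  have hg : ∀ n t, g^[n] t = F^[α * n] t - n * e := by
    intro n t
    induction n with
    | zero => simp
    | succ n ih =>
      have h1 : F^[α] (F^[α * n] t - ((n * e : ℕ) : ℝ)) = F^[α] (F^[α * n] t) - ((n * e : ℕ) : ℝ) := by
        rw [← CircleDeg1Lift.coe_pow, CircleDeg1Lift.map_sub_nat]
      rw [Function.iterate_succ_apply', ih]
      change F^[α] (F^[α * n] t - n * e) - e = _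
      rw [← Nat.cast_mul, h1, ← Function.iterate_add_apply, Nat.mul_succ, add_comm α]
      push_cast
      ring
  refine ⟨g, fun t => ?_, fun i t => ?_⟩
  · rw [hg, mul_comm, iterate_mul_eq_add h]
    have : (j : ℝ) * α = 1 + q * e := by exact_mod_cast hαe
    linear_combination this
  · have h1 : α * (i * j) = i + q * (i * e) := by
      calc α * (i * j) = i * (j * α) := by ring
        _ = _ := by rw [hαe]; ring
    rw [hg, h1, Function.iterate_add_apply, iterate_mul_eq_add h, ← Nat.cast_mul,
      ← CircleDeg1Lift.coe_pow, CircleDeg1Lift.map_add_nat]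
    push_cast
    ring

theorem cos_nonneg_iff_le {x : ℝ} (h1 : -1 / 4 ≤ x) (h2 : x < 3 / 4) :
    0 ≤ Real.cos (2 * Real.pi * x) ↔ x ≤ 1 / 4 := by
  have hpi := Real.pi_pos
  constructor
  · intro h
    by_contra! hx
    refine absurd h (not_le.mpr (Real.cos_neg_of_pi_div_two_lt_of_lt ?_ ?_)) <;> nlinarith
  · intro hx
    apply Real.cos_nonneg_of_neg_pi_div_two_le_of_le <;> nlinarith

/-- Along a periodic orbit of rotation number `j / q` issued from the bottom of the circle, the
signs of the abscissae form a rotation word. -/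
theorem exists_rotation_word (F : CircleDeg1Lift) {q j : ℕ} (hq : 1 < q) (hj : Nat.Coprime j q)
    (h : ∀ t, F^[q] t = t + j) : ∃ n ∈ Finset.Icc 1 q, ∀ i,
      0 ≤ Real.cos (2 * Real.pi * F^[i] (-1 / 4)) ↔ i * j % q < n := by
  classical
  obtain ⟨g, hg, hgF⟩ := exists_root_of_periodic F hq hj h
  have hlt : ∀ t, t < g t := fun t => by
    have := (g.lt_iterate_pos_iff (x := t) (m := 0) (n := q) (by omega)).mp (by rw [hg]; simp)
    simpa using this
  have hmono : StrictMono fun n => g^[n] (-1 / 4) := strictMono_nat_of_lt_succ fun n => by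
    simp only [Function.iterate_succ_apply']; exact hlt _
  have hex : ∃ n, ¬ g^[n] (-1 / 4) ≤ 1 / 4 := ⟨q, by rw [hg]; norm_num⟩
  -- The points `g^k (-1/4)`, `k < q`, increase within `[-1/4, 3/4)`; `n` counts those in the right
  -- half circle. Up to an integer, `F^i` lands on index `i * j % q`.
  refine ⟨Nat.find hex, Finset.mem_Icc.mpr ⟨?_, ?_⟩, fun i => ?_⟩
  · rw [Nat.one_le_iff_ne_zero, Ne, Nat.find_eq_zero]
    norm_num
  · exact Nat.find_min' hex (by rw [hg]; norm_num)
  · have hr : i * j % q < q := Nat.mod_lt _ (by omega)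
    have h1 : F^[i] (-1 / 4) = g^[i * j % q] (-1 / 4) + (i * j / q : ℕ) := by
      have h2 := iterate_mul_eq_add (F := g) (q := q) (j := 1) (by simpa using hg) (i * j / q)
      rw [← hgF, ← Nat.mod_add_div (i * j) q, Function.iterate_add_apply, h2,
        Nat.cast_one, mul_one, ← CircleDeg1Lift.coe_pow, CircleDeg1Lift.map_add_nat,
        Nat.mod_add_div, CircleDeg1Lift.coe_pow]
    have h3 : 2 * Real.pi * (g^[i * j % q] (-1 / 4) + (i * j / q : ℕ)) =
        2 * Real.pi * g^[i * j % q] (-1 / 4) + (i * j / q : ℕ) * (2 * Real.pi) := by ring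
    rw [h1, h3, Real.cos_add_nat_mul_two_pi, cos_nonneg_iff_le, Nat.lt_find_iff]
    · simp only [not_not]
      exact ⟨fun h n hn => (hmono.monotone hn).trans h, fun h => h _ le_rfl⟩
    · exact hmono.monotone (Nat.zero_le _)
    · have := hmono hr
      simp only [hg] at this
      linarith

/-- The orbit equations satisfied at a parameter with degenerate rotation interval. -/
theorem exists_signs_of_mem_degenerateSet {q j : ℕ} (hq : 1 < q) (hj : Nat.Coprime j q) {μ : ℝ}
    (hμ : μ ∈ degenerateSet (j / q)) : ∃ ν : ℝ, ∃ n ∈ Finset.Icc 1 q, ∃ u : ℕ → ℝ,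
      u 0 = 0 ∧ u 1 = 1 ∧ u q = 0 ∧ u (q - 1) = -1 ∧ (∀ i, 0 ≤ u i ↔ i * j % q < n) ∧
      ∀ i, u (i + 2) = (if (i + 1) * j % q < n then ν + μ else ν - μ) * u (i + 1) - u i := by
  obtain ⟨-, ν, hν⟩ := hμ
  obtain ⟨F, hF, hτ⟩ : HasRotationNumber (S μ ν) (j / q) := by
    have : ν ∈ rotationInterval μ (j / q) := by rw [hν]; rfl
    exact this
  have hper : ∀ t, F^[q] t = t + j := fun t => by
    rw [← CircleDeg1Lift.coe_pow]
    exact pow_eq_add_of_rotationInterval_eq_singleton (by omega) hν hF hτ t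
  obtain ⟨n, hn, hsign⟩ := exists_rotation_word F hq hj hper
  have hq0 := T_iterate_zero_neg_one (μ := μ) (ν := ν) (q := q)
    fun v hv => hF.T_iterate_of_periodic hper hv
  have h0 : unitVec (-1 / 4) = (0, -1) := by
    have : 2 * Real.pi * (-1 / 4) = -(Real.pi / 2) := by ring
    rw [unitVec, this, Real.cos_neg, Real.sin_neg, Real.cos_pi_div_two, Real.sin_pi_div_two]
  set u : ℕ → ℝ := fun i => ((T μ ν)^[i] (0, -1)).1 with hu
  have hsnd : ∀ i, ((T μ ν)^[i + 1] (0, -1)).2 = u i := fun i => by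
    rw [Function.iterate_succ_apply']; rfl
  have husign : ∀ i, 0 ≤ u i ↔ i * j % q < n := fun i => by
    obtain ⟨ρ, hρ, h⟩ := hF.T_iterate_unitVec (-1 / 4) i
    rw [h0] at h
    rw [← hsign, hu]
    simp only [h, unitVec, Prod.smul_fst, smul_eq_mul, mul_nonneg_iff_of_pos_left hρ]
  refine ⟨ν, n, hn, u, rfl, by simp [hu, T, planeMap], by simp [hu, hq0], ?_, husign, fun i => ?_⟩
  · rw [← hsnd, Nat.sub_add_cancel hq.le, hq0]
  · have h1 : u (i + 2) = slopeFn (ν + μ) (ν - μ) (u (i + 1)) * u (i + 1) - u i := by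
      rw [← hsnd i, hu]
      simp only [Function.iterate_succ_apply' _ (i + 1)]
      rfl
    simp only [h1, slopeFn, husign]

/-! ### Counting roots over the rotation words. -/

theorem card_bound {q : ℕ} (hq : 3 ≤ q) (hq4 : q ≠ 4) :
    q * (2 * (q - 1) * (q - 2)) ≤ 2 ^ (q - 1) * (2 * q - 1) := by
  obtain ⟨n, rfl⟩ : ∃ n, q = n + 3 := ⟨q - 3, by omega⟩
  rcases lt_or_ge n 4 with h | h
  · interval_cases n <;> simp_all
  have key : (n + 3) * (n + 2) ≤ 2 ^ (n + 2) := by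
    induction n, h using Nat.le_induction with
    | base => norm_num
    | succ n hn ih =>
      have := ih (by omega) (by omega)
      rw [show n + 1 + 2 = n + 2 + 1 by ring, pow_succ]
      nlinarith
  calc (n + 3) * (2 * (n + 3 - 1) * (n + 3 - 2)) = ((n + 3) * (n + 2)) * (2 * (n + 1)) := by
        rw [show n + 3 - 1 = n + 2 by omega, show n + 3 - 2 = n + 1 by omega]; ring
    _ ≤ 2 ^ (n + 2) * (2 * (n + 3) - 1) := Nat.mul_le_mul key (by omega)

/-- The degenerate set lies in the zero set of few polynomials with rational coefficients. -/
theorem exists_polynomials_degenerateSet {q j : ℕ} (hq : q.Prime) (hq3 : 3 ≤ q)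
    (hj : Nat.Coprime j q) : ∃ R : ℕ → Polynomial ℚ,
      (∀ n, R n ≠ 0 ∧ (R n).natDegree ≤ 2 * (q - 1) * (q - 2)) ∧
      ∀ μ ∈ degenerateSet (j / q), ∃ n ∈ Finset.Icc 1 q, Polynomial.aeval μ (R n) = 0 := by
  have hR : ∀ n : ℕ, ∃ R : Polynomial ℚ, (R ≠ 0 ∧ R.natDegree ≤ 2 * (q - 1) * (q - 2)) ∧
      (1 * j % q < n → ¬ (q - 1) * j % q < n → ∀ μ ν : ℝ,
        (∃ u : ℕ → ℝ, u 0 = 0 ∧ u 1 = 1 ∧ u q = 0 ∧ u (q - 1) = -1 ∧ ∀ i < q - 1,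
          u (i + 2) = (if (i + 1) * j % q < n then ν + μ else ν - μ) * u (i + 1) - u i) →
        Polynomial.aeval μ R = 0) := by
    intro n
    by_cases hs : 1 * j % q < n ∧ ¬ (q - 1) * j % q < n
    · obtain ⟨R, h1, h2, h3⟩ := exists_polynomial_of_signs (fun i => i * j % q < n) hq hq3 hs.1 hs.2
      exact ⟨R, ⟨h1, h2⟩, fun _ _ => h3⟩
    -- Words with the wrong sign at `1` or `q - 1` do not occur; the rootless polynomial `1` stands
    -- in for them.
    · exact ⟨1, ⟨one_ne_zero, by simp⟩, fun h1 h2 => absurd ⟨h1, h2⟩ hs⟩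
  choose R hR1 hR2 using hR
  refine ⟨R, hR1, fun μ hμ => ?_⟩
  obtain ⟨ν, n, hn, u, hu0, hu1, huq, huq', hs, hu⟩ :=
    exists_signs_of_mem_degenerateSet hq.one_lt hj hμ
  refine ⟨n, hn, hR2 n ((hs 1).mp (by rw [hu1]; norm_num)) (fun h => ?_) μ ν
    ⟨u, hu0, hu1, huq, huq', fun i _ => hu i⟩⟩
  have := (hs (q - 1)).mpr h
  rw [huq'] at this
  norm_num at this

end PLMap

theorem theorem4p2 (q j : ℕ) (hq : q.Prime) (hq3 : 3 ≤ q) (hj : 1 ≤ j) (hjq : j ≤ (q - 1) / 2) :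
    (PLMap.degenerateSet ((j : ℝ) / (q : ℝ))).Finite ∧
      (∀ μ ∈ PLMap.degenerateSet ((j : ℝ) / (q : ℝ)), IsAlgebraic ℚ μ) ∧
      (PLMap.degenerateSet ((j : ℝ) / (q : ℝ))).ncard ≤ 2 ^ (q - 1) * (2 * q - 1) := by
  classical
  have hcop : Nat.Coprime j q := (Nat.coprime_of_lt_prime (by omega) (by omega) hq).symm
  obtain ⟨R, hR, hroot⟩ := PLMap.exists_polynomials_degenerateSet hq hq3 hcop
  set A : Finset ℝ := (Finset.Icc 1 q).biUnion fun n => ((R n).aroots ℝ).toFinset with hA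
  have hsub : PLMap.degenerateSet ((j : ℝ) / (q : ℝ)) ⊆ A := by
    intro μ hμ
    obtain ⟨n, hn, h⟩ := hroot μ hμ
    simp only [hA, Finset.coe_biUnion, Set.mem_iUnion]
    exact ⟨n, hn, by simpa using Polynomial.mem_aroots.mpr ⟨(hR n).1, h⟩⟩
  refine ⟨A.finite_toSet.subset hsub, fun μ hμ => ?_, ?_⟩
  · obtain ⟨n, -, h⟩ := hroot μ hμ
    exact ⟨R n, (hR n).1, h⟩
  · refine (Set.ncard_le_ncard hsub A.finite_toSet).trans ?_
    rw [Set.ncard_coe_finset]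
    refine (Finset.card_biUnion_le_card_mul _ _ (2 * (q - 1) * (q - 2)) fun n _ => ?_).trans ?_
    · refine (Multiset.toFinset_card_le _).trans ((Polynomial.card_roots' _).trans ?_)
      exact Polynomial.natDegree_map_le.trans (hR n).2
    · rw [Nat.card_Icc, Nat.add_sub_cancel]
      exact PLMap.card_bound hq3 (by rintro rfl; norm_num at hq)
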